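/- Let $p$ be a prime and let $\mathscr{Q}$ be an expansion of the field $\mathbb{Q}_p$ of $p$-adic numbers: a first-order structure with underlying set $\mathbb{Q}_p$, in a language $L$ (of any cardinality) extending the language of rings, whose reduct to the language of rings is the field $\mathbb{Q}_p$. If $\mathscr{Q}$ is dp-minimal, then $\mathscr{Q}$ is $\mathbb{Q}_p$-minimal: every subset $X \subseteq \mathbb{Q}_p$ that is definable, with parameters, in $\mathscr{Q}$ is already definable, with parameters, in the field $\mathbb{Q}_p$. Here $\mathscr{Q}$ is dp-minimal if its complete theory $T = \mathrm{Th}(\mathscr{Q})$ has dp-rank at most $1$, that is, if the following holds in every model $\mathscr{N}$ of $T$ (equivalently, in every sufficiently saturated one): whenever $A \subseteq N$, $I_0 = (a_i)_{i \in \mathbb{N}}$ and $I_1 = (b_i)_{i \in \mathbb{N}}$ are sequences of finite tuples from $N$ (of fixed length within each sequence) that are mutually indiscernible over $A$, meaning that $I_0$ is indiscernible over $A \cup I_1$ and $I_1$ is indiscernible over $A \cup I_0$, and $b \in N$ is a single element, then $I_0$ or $I_1$ is indiscernible over $A \cup \{b\}$. -/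

import Mathlib

universe u v w x

namespace FirstOrder.Language

/-- A sequence `I 0, I 1, …` of `n`-tuples of elements of `N` is indiscernible over a set `B` of
parameters: any two increasing finite subsequences of the same length satisfy the same formulas
with parameters from `B`. -/
def IsIndiscernible (L : Language.{u, v}) {N : Type w} [L.Structure N] (B : Set N) {n : ℕ}
    (I : ℕ → Fin n → N) : Prop :=
  ∀ (k : ℕ) (φ : L[[B]].Formula (Fin k × Fin n)) (i j : Fin k → ℕ),
    StrictMono i → StrictMono j →
      (φ.Realize (fun a => I (i a.1) a.2) ↔ φ.Realize (fun a => I (j a.1) a.2))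

/-- The set of all elements of `N` that occur as a coordinate of a tuple of the sequence `I`. -/
def sequenceElements {N : Type w} {n : ℕ} (I : ℕ → Fin n → N) : Set N :=
  {c | ∃ (i : ℕ) (a : Fin n), I i a = c}

/-- A family `(I t)` of sequences of finite tuples (the length `n t` of the tuples may depend on
the sequence) is mutually indiscernible over `A`: each `I t` is indiscernible over `A` together
with all elements of the other sequences. -/
def MutuallyIndiscernible (L : Language.{u, v}) {N : Type w} [L.Structure N] (A : Set N)
    {ι : Type x} {n : ι → ℕ} (I : (t : ι) → ℕ → Fin (n t) → N) : Prop :=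
  ∀ t : ι, L.IsIndiscernible (A ∪ ⋃ s ∈ {s : ι | s ≠ t}, sequenceElements (I s)) (I t)

/-- `T.DpRankLT ι` says that the dp-rank of `T` is smaller than the cardinality of `ι`: for every
family, indexed by `ι`, of sequences of finite tuples in a model of `T` that is mutually
indiscernible over a set `A`, and every single element `b`, one of the sequences is indiscernible
over `A ∪ {b}`. -/
def Theory.DpRankLT {L : Language.{u, v}} (T : L.Theory) (ι : Type x) : Prop :=
  ∀ (N : Type (max u v)) [L.Structure N] [Nonempty N] [N ⊨ T] (A : Set N) (n : ι → ℕ)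
    (I : (t : ι) → ℕ → Fin (n t) → N),
    L.MutuallyIndiscernible A I → ∀ b : N, ∃ t : ι, L.IsIndiscernible (insert b A) (I t)

/-- A theory is dp-minimal if its dp-rank is at most one, that is, smaller than two. -/
def Theory.IsDpMinimal {L : Language.{u, v}} (T : L.Theory) : Prop :=
  T.DpRankLT (Fin 2)

/-- A structure is dp-minimal if its complete theory is. -/
def IsDpMinimal (L : Language.{u, v}) (M : Type w) [L.Structure M] : Prop :=
  (L.completeTheory M).IsDpMinimal

/-- For an expansion to `L'` of an `L`-structure on `M`: the expansion is minimal over its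
`L`-reduct, that is, every subset of `M` (in one variable) that is definable with parameters in
the language `L'` is definable with parameters in the language `L`. -/
def IsMinimalOver (L : Language.{u, v}) (L' : Language.{w, x}) (M : Type*) [L.Structure M]
    [L'.Structure M] : Prop :=
  ∀ X : Set M, (Set.univ : Set M).Definable₁ L' X → (Set.univ : Set M).Definable₁ L X

end FirstOrder.Language

/-! Dp-minimality enters only through `not_isDpMinimal_of_crossing`: two definable families cannot
cross in n by n grids for every n. Take the sets {x : x a ∈ X} and the balls {x : ‖x‖ ≤ ‖b‖}. For
some n, given any n scalars and n radii, two of the first sets agree on the annulus between two of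
the radii.

With units as scalars, Neumann's lemma on coset covers bounds the index of the stabiliser of X on
every small enough sphere, so a fixed power of each unit preserves X near 0. With the scalars p ^ i,
some power of p preserves X near 0. Hence the germ of X at 0 is invariant under N-th powers for some
N ≠ 0. Nonzero p-adic numbers fall into finitely many classes modulo N-th powers, so this germ is
definable in the field. Translation and inversion carry this to every point and to infinity, and
compactness of balls glues finitely many germs. -/

namespace Ultrafilter

/-! ### Iterated powers of an ultrafilter -/

open Filter

/-- The `n`-fold iterated (Fubini) power of an ultrafilter. -/
def iteratedPower {α : Type*} (U : Ultrafilter α) : (n : ℕ) → Ultrafilter (Fin n → α)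
  | 0 => pure Fin.elim0
  | n + 1 => U.bind fun a => (iteratedPower U n).map fun s => (Fin.cons a s : Fin (n + 1) → α)

theorem eventually_iteratedPower_succ {α : Type*} (U : Ultrafilter α) (n : ℕ)
    (P : (Fin (n + 1) → α) → Prop) :
    (∀ᶠ s in U.iteratedPower (n + 1), P s) ↔
      ∀ᶠ a in U, ∀ᶠ s in U.iteratedPower n, P (Fin.cons a s) :=
  Iff.rfl

/-- Coordinates outside the range of `i` do not matter: a quantifier over an ultrafilter is vacuous
on a constant statement. The induction splits on whether `i` uses the first coordinate. -/
theorem eventually_iteratedPower_comp {α : Type*} (U : Ultrafilter α) {n k : ℕ}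
    (i : Fin k → Fin n) (hi : StrictMono i) (P : (Fin k → α) → Prop) :
    (∀ᶠ s in U.iteratedPower n, P (s ∘ i)) ↔ ∀ᶠ s in U.iteratedPower k, P s := by
  induction n generalizing k with
  | zero =>
    cases k with
    | zero =>
      have : ∀ s : Fin 0 → α, s ∘ i = s := fun s => Subsingleton.elim _ _
      simp only [this]
    | succ k => exact (i 0).elim0
  | succ n ih =>
    cases k with
    | zero =>
      have h : ∀ s : Fin 0 → α, s = Fin.elim0 := fun s => Subsingleton.elim _ _
      simp only [eventually_const, h]
    | succ k =>
      rw [eventually_iteratedPower_succ]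
      have hpos : ∀ j : Fin (k + 1), j ≠ 0 → i j ≠ 0 := fun j hj h => by
        have := hi (Fin.pos_of_ne_zero hj)
        rw [h] at this
        exact absurd this (Fin.not_lt_zero _)
      by_cases h0 : i 0 = 0
      · rw [eventually_iteratedPower_succ]
        refine eventually_congr (Eventually.of_forall fun a => ?_)
        have hne : ∀ j : Fin k, i j.succ ≠ 0 := fun j => hpos _ (Fin.succ_ne_zero j)
        rw [← ih (fun j => (i j.succ).pred (hne j))
          (fun a b hab => by simpa using hi (Fin.succ_lt_succ_iff.2 hab))]
        refine eventually_congr (Eventually.of_forall fun s => ?_)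
        have : (Fin.cons a s : Fin (n + 1) → α) ∘ i =
            Fin.cons a (s ∘ fun j => (i j.succ).pred (hne j)) := by
          funext j
          refine Fin.cases ?_ (fun j => ?_) j
          · simp [h0]
          · rw [Function.comp_apply, Fin.cons_succ, Function.comp_apply]
            conv_lhs => rw [← Fin.succ_pred (i j.succ) (hne j)]
            rw [Fin.cons_succ]
        rw [this]
      · have hne : ∀ j, i j ≠ 0 := fun j => by
          rcases eq_or_ne j 0 with rfl | hj
          · exact h0
          · exact hpos j hj
        have key : ∀ a, (∀ᶠ s in U.iteratedPower n, P ((Fin.cons a s : Fin (n + 1) → α) ∘ i)) ↔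
            ∀ᶠ s in U.iteratedPower (k + 1), P s := fun a => by
          rw [← ih (fun j => (i j).pred (hne j))
            (fun a b hab => by simpa using hi hab)]
          refine eventually_congr (Eventually.of_forall fun s => ?_)
          have : (Fin.cons a s : Fin (n + 1) → α) ∘ i = s ∘ fun j => (i j).pred (hne j) := by
            funext j
            rw [Function.comp_apply, Function.comp_apply]
            conv_lhs => rw [← Fin.succ_pred (i j) (hne j)]
            rw [Fin.cons_succ]
          rw [this]
        simp only [key, eventually_const]

/-- The finite powers are compatible under restriction, so their pullbacks to sequences form a
decreasing chain of proper filters; any ultrafilter below all of them works. -/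
theorem exists_infinite_iteratedPower {α : Type*} [Nonempty α] (U : Ultrafilter α) :
    ∃ W : Ultrafilter (ℕ → α), ∀ (k : ℕ) (i : Fin k → ℕ), StrictMono i →
      ∀ P : (Fin k → α) → Prop,
        (∀ᶠ σ in W, P (σ ∘ i)) ↔ ∀ᶠ s in U.iteratedPower k, P s := by
  let r : (n : ℕ) → (ℕ → α) → Fin n → α := fun n σ j => σ j
  let F : ℕ → Filter (ℕ → α) := fun n => Filter.comap (r n) (U.iteratedPower n)
  have hsurj : ∀ n, Function.Surjective (r n) := fun n s => by
    refine ⟨fun m => if h : m < n then s ⟨m, h⟩ else Classical.arbitrary α, ?_⟩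
    funext j
    simp [r]
  have hF : ∀ n, (F n).NeBot := fun n => (U.iteratedPower n).neBot.comap_of_surj (hsurj n)
  have hanti : Antitone F := fun n m hnm => by
    intro A hA
    obtain ⟨t, ht, htA⟩ := hA
    refine ⟨{s | s ∘ Fin.castLE hnm ∈ t}, ?_, fun σ hσ => htA hσ⟩
    exact (eventually_iteratedPower_comp U (Fin.castLE hnm) (Fin.strictMono_castLE hnm)
      (fun s => s ∈ t)).2 ht
  have hne : (⨅ n, F n).NeBot := iInf_neBot_of_directed hanti.directed_ge hF
  let W := Ultrafilter.of (⨅ n, F n)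
  have hW : ∀ n (P : (Fin n → α) → Prop), (∀ᶠ s in U.iteratedPower n, P s) →
      ∀ᶠ σ in W, P (r n σ) := fun n P h =>
    (Ultrafilter.of_le _).trans (iInf_le F n) (preimage_mem_comap h)
  refine ⟨W, fun k i hi P => ?_⟩
  obtain ⟨n, hn⟩ : ∃ n, ∀ j, i j < n := by
    obtain ⟨b, hb⟩ := (Set.finite_range i).bddAbove
    exact ⟨b + 1, fun j => Nat.lt_succ_of_le (hb ⟨j, rfl⟩)⟩
  let i' : Fin k → Fin n := fun j => ⟨i j, hn j⟩
  have hi' : StrictMono i' := fun a b hab => hi hab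
  have h : ∀ Q : (Fin k → α) → Prop, (∀ᶠ s in U.iteratedPower k, Q s) → ∀ᶠ σ in W, Q (σ ∘ i) :=
    fun Q hQ => hW n _ ((eventually_iteratedPower_comp U i' hi' Q).2 hQ)
  refine ⟨fun hP => ?_, h P⟩
  by_contra hcon
  have := h (fun s => ¬ P s) (Ultrafilter.eventually_not.2 hcon)
  exact (Ultrafilter.eventually_not.1 this) hP

/-- Takes the place of Ramsey's theorem: a generic sequence is indiscernible for every predicate,
and nonprincipality makes its first two terms increase. -/
theorem exists_indiscernible_ultrafilter :
    ∃ W : Ultrafilter (ℕ → ℕ),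
      (∀ (k : ℕ) (i j : Fin k → ℕ), StrictMono i → StrictMono j → ∀ P : (Fin k → ℕ) → Prop,
        ((∀ᶠ σ in W, P (σ ∘ i)) ↔ ∀ᶠ σ in W, P (σ ∘ j))) ∧
      ∀ᶠ σ : ℕ → ℕ in (W : Filter (ℕ → ℕ)), σ 0 < σ 1 := by
  obtain ⟨W, hW⟩ := exists_infinite_iteratedPower (hyperfilter ℕ)
  refine ⟨W, fun k i j hi hj P => (hW k i hi P).trans (hW k j hj P).symm, ?_⟩
  refine (hW 2 Fin.val Fin.val_strictMono (fun s => s 0 < s 1)).2 ?_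
  rw [eventually_iteratedPower_succ]
  refine Eventually.of_forall fun a => ?_
  rw [eventually_iteratedPower_succ]
  refine (Filter.Eventually.filter_mono Nat.hyperfilter_le_atTop (eventually_gt_atTop a)).mono
    fun b hb => ?_
  exact Eventually.of_forall fun s => hb

end Ultrafilter

/-! ### Crossing families in an ultrapower -/

namespace FirstOrder.Language

open Filter

theorem realize_iff_exists_formula_sum {L : Language.{u, v}} {N : Type w} [L.Structure N]
    (B : Set N) {α : Type x} (φ : L[[B]].Formula α) :
    ∃ ψ : L.Formula (B ⊕ α), ∀ y : α → N,
      φ.Realize y ↔ ψ.Realize (Sum.elim (fun b : B => (b : N)) y) := by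
  obtain ⟨ψ, hψ⟩ := Set.definable_iff_exists_formula_sum.1
    (⟨φ, rfl⟩ : B.Definable L (Set.ofPred φ.Realize))
  exact ⟨ψ, fun y => Set.ext_iff.1 hψ y⟩

theorem exists_formula_realize_iff {L : Language.{u, v}} {N : Type w} [L.Structure N]
    (B : Set N) {α : Type x} (ψ : L.Formula (B ⊕ α)) :
    ∃ φ : L[[B]].Formula α, ∀ y : α → N,
      φ.Realize y ↔ ψ.Realize (Sum.elim (fun b : B => (b : N)) y) := by
  obtain ⟨φ, hφ⟩ := Set.definable_iff_exists_formula_sum.2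
    (⟨ψ, rfl⟩ : ∃ φ : L.Formula (B ⊕ α), {v | ψ.Realize (Sum.elim (fun b : B => (b : N)) v)} =
      {v | φ.Realize (Sum.elim (fun b : B => (b : N)) v)})
  exact ⟨φ, fun y => (Set.ext_iff.1 hφ y).symm⟩

/-- The ultrapower of `M` by `V`. -/
abbrev Ultrapower {Ω : Type*} (V : Ultrafilter Ω) (M : Type*) :=
  (V : Filter Ω).Product fun _ => M

/-- The element of an ultrapower represented by a function. -/
abbrev Ultrapower.mk {Ω : Type*} (V : Ultrafilter Ω) {M : Type*} (f : Ω → M) : Ultrapower V M :=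
  (f : (V : Filter Ω).Product fun _ => M)

/-- A sequence of tuples in an ultrapower is indiscernible over `B` if it is so on representatives,
where `P` is a property shared by suitable representatives of the elements of `B`. -/
theorem isIndiscernible_ultrapower {L : Language.{u, v}} {M : Type*} [L.Structure M] [Nonempty M]
    {Ω : Type*} (V : Ultrafilter Ω) {n : ℕ} (I : ℕ → Fin n → Ω → M) (P : (Ω → M) → Prop)
    (B : Set (Ultrapower V M))
    (hB : ∀ b ∈ B, ∃ f : Ω → M, P f ∧ Ultrapower.mk V f = b)
    (h : ∀ (k : ℕ) (i j : Fin k → ℕ), StrictMono i → StrictMono j →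
      ∀ (g : B → Ω → M), (∀ b, P (g b)) → ∀ φ : L.Formula (B ⊕ (Fin k × Fin n)),
        ((∀ᶠ ω in V, φ.Realize (Sum.elim (fun b => g b ω) fun a => I (i a.1) a.2 ω)) ↔
          ∀ᶠ ω in V, φ.Realize (Sum.elim (fun b => g b ω) fun a => I (j a.1) a.2 ω))) :
    L.IsIndiscernible B
      (fun i a => Ultrapower.mk V (I i a)) := by
  intro k φ i j hi hj
  obtain ⟨ψ, hψ⟩ := realize_iff_exists_formula_sum B φ
  choose g hgP hg using fun b : B => hB b b.2
  have key : ∀ i : Fin k → ℕ, φ.Realize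
      (fun a => Ultrapower.mk V (I (i a.1) a.2)) ↔
      ∀ᶠ ω in V, ψ.Realize (Sum.elim (fun b => g b ω) fun a => I (i a.1) a.2 ω) := by
    intro i
    rw [hψ]
    have := Ultraproduct.realize_formula_cast (u := V) (M := fun _ => M) ψ
      (Sum.elim g fun a => I (i a.1) a.2)
    convert! this using 2
    · funext z
      rcases z with z | z
      · exact (hg z).symm
      · rfl
    · funext ω
      congr 1
      funext z
      rcases z with z | z <;> rfl
  rw [key, key]
  exact h k i j hi hj g hgP ψ

theorem not_isIndiscernible_insert {L : Language.{u, v}} {M : Type*} [L.Structure M] [Nonempty M]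
    {Ω : Type*} (V : Ultrafilter Ω) (I : ℕ → Fin 1 → Ω → M) (ξ : Ω → M)
    (A : Set (Ultrapower V M))
    (hA : ∀ m : M, Ultrapower.mk V (fun _ => m) ∈ A)
    {R : Set (Fin 2 → M)} (hR : (Set.univ : Set M).Definable L R)
    (h : ∀ᶠ ω in V, ¬ (![ξ ω, I 0 0 ω] ∈ R ↔ ![ξ ω, I 1 0 ω] ∈ R)) :
    ¬ L.IsIndiscernible (insert (Ultrapower.mk V ξ) A)
      (fun i a => Ultrapower.mk V (I i a)) := by
  intro hind
  obtain ⟨ψ, rfl⟩ := Set.definable_iff_exists_formula_sum.1 hR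
  let B : Set (Ultrapower V M) := insert (Ultrapower.mk V ξ) A
  let ρ : (Set.univ : Set M) ⊕ Fin 2 → B ⊕ (Fin 1 × Fin 1) :=
    Sum.elim (fun m => Sum.inl ⟨Ultrapower.mk V (fun _ => (m : M)), Set.mem_insert_of_mem _ (hA m)⟩)
      ![Sum.inl ⟨(Ultrapower.mk V ξ), Set.mem_insert _ _⟩, Sum.inr (0, 0)]
  obtain ⟨φ, hφ⟩ := exists_formula_realize_iff B (ψ.relabel ρ)
  have key : ∀ i : ℕ, φ.Realize (fun a => Ultrapower.mk V (I i a.2)) ↔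
      ∀ᶠ ω in V, ![ξ ω, I i 0 ω] ∈
        {v : Fin 2 → M | ψ.Realize (Sum.elim (fun b : (Set.univ : Set M) => (b : M)) v)} := by
    intro i
    rw [hφ, Formula.realize_relabel]
    have := Ultraproduct.realize_formula_cast (u := V) (M := fun _ => M) ψ
      (Sum.elim (fun m _ => (m : M)) ![ξ, I i 0])
    convert! this using 2
    · funext z
      rcases z with z | z
      · rfl
      · fin_cases z <;> rfl
    · funext ω
      rw [Set.mem_ofPred_eq]
      congr 1
      funext z
      rcases z with z | z
      · rfl
      · fin_cases z <;> rfl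
  have h01 := hind 1 φ (fun _ => 0) (fun _ => 1) (Subsingleton.strictMono _)
    (Subsingleton.strictMono _)
  rw [key, key] at h01
  by_cases h0 : ∀ᶠ ω in V, ![ξ ω, I 0 0 ω] ∈
      {v : Fin 2 → M | ψ.Realize (Sum.elim (fun b : (Set.univ : Set M) => (b : M)) v)}
  · obtain ⟨ω, h1, h2, h3⟩ := (h.and (h0.and (h01.1 h0))).exists
    exact h1 (iff_of_true h2 h3)
  · have h1 := mt h01.2 h0
    rw [← Ultrafilter.eventually_not] at h0 h1
    obtain ⟨ω, h1, h2, h3⟩ := (h.and (h0.and h1)).exists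
    exact h1 (iff_of_false h2 h3)

/-- Two definable families of subsets of `M` that cross each other arbitrarily often witness that
`M` is not dp-minimal. -/
theorem not_isDpMinimal_of_crossing {L : Language.{u, v}} {M : Type} [L.Structure M] [Nonempty M]
    {R S : Set (Fin 2 → M)} (hR : (Set.univ : Set M).Definable L R)
    (hS : (Set.univ : Set M).Definable L S)
    (h : ∀ n : ℕ, ∃ a b : ℕ → M, ∀ i i' j j', i < i' → i' < n → j < j' → j' < n → ∃ x,
      ¬ (![x, a i] ∈ R ↔ ![x, a i'] ∈ R) ∧ ¬ (![x, b j] ∈ S ↔ ![x, b j'] ∈ S)) :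
    ¬ L.IsDpMinimal M := by
  intro hdp
  choose a b hab using h
  obtain ⟨W, hW, hlt⟩ := Ultrafilter.exists_indiscernible_ultrafilter
  -- Two independent generic index sequences, then a grid size `n` chosen last so that it exceeds
  -- the indices used. The lift puts the ultrapower in the universe over which `Theory.DpRankLT`
  -- quantifies.
  let V : Ultrafilter (ULift.{max u v} ((ℕ → ℕ) × (ℕ → ℕ) × ℕ)) :=
    W.bind fun σ => W.bind fun τ => (hyperfilter ℕ).map fun n => ULift.up (σ, τ, n)
  let Ω := ULift.{max u v} ((ℕ → ℕ) × (ℕ → ℕ) × ℕ)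
  have hV : ∀ P : Ω → Prop, (∀ᶠ ω in V, P ω) ↔
      ∀ᶠ σ in W, ∀ᶠ τ in W, ∀ᶠ n in hyperfilter ℕ, P (ULift.up (σ, τ, n)) := fun P => Iff.rfl
  let I : Fin 2 → ℕ → Fin 1 → Ω → M :=
    ![fun i _ ω => a ω.down.2.2 (ω.down.1 i), fun j _ ω => b ω.down.2.2 (ω.down.2.1 j)]
  let A : Set (Ultrapower V M) := Set.range fun m : M => Ultrapower.mk V fun _ => m
  have hex : ∀ ω : Ω, ∃ x, ω.down.1 0 < ω.down.1 1 → ω.down.1 1 < ω.down.2.2 →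
      ω.down.2.1 0 < ω.down.2.1 1 → ω.down.2.1 1 < ω.down.2.2 →
      ¬ (![x, I 0 0 0 ω] ∈ R ↔ ![x, I 0 1 0 ω] ∈ R) ∧
      ¬ (![x, I 1 0 0 ω] ∈ S ↔ ![x, I 1 1 0 ω] ∈ S) := by
    intro ω
    by_cases hω : ω.down.1 0 < ω.down.1 1 ∧ ω.down.1 1 < ω.down.2.2 ∧
      ω.down.2.1 0 < ω.down.2.1 1 ∧ ω.down.2.1 1 < ω.down.2.2
    · obtain ⟨x, hx⟩ := hab _ _ _ _ _ hω.1 hω.2.1 hω.2.2.1 hω.2.2.2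
      exact ⟨x, fun _ _ _ _ => hx⟩
    · exact ⟨Classical.arbitrary M, fun h1 h2 h3 h4 => absurd ⟨h1, h2, h3, h4⟩ hω⟩
  choose ξ hξ using hex
  have hξV : ∀ᶠ ω in V, ¬ (![ξ ω, I 0 0 0 ω] ∈ R ↔ ![ξ ω, I 0 1 0 ω] ∈ R) ∧
      ¬ (![ξ ω, I 1 0 0 ω] ∈ S ↔ ![ξ ω, I 1 1 0 ω] ∈ S) := by
    rw [hV]
    filter_upwards [hlt] with σ hσ
    filter_upwards [hlt] with τ hτ
    have hn : ∀ m : ℕ, ∀ᶠ n in hyperfilter ℕ, m < n := fun m =>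
      Filter.Eventually.filter_mono Nat.hyperfilter_le_atTop (eventually_gt_atTop m)
    filter_upwards [hn (σ 1), hn (τ 1)] with n h1 h2
    exact hξ _ hσ h1 hτ h2
  have : (Ultrapower V M) ⊨ L.completeTheory M := by
    refine ⟨fun φ hφ => ?_⟩
    rw [Ultraproduct.sentence_realize]
    exact Eventually.of_forall fun _ => hφ
  have hmem : ∀ (t : Fin 2) (B : Set (Ultrapower V M)),
      B = A ∪ ⋃ s ∈ {s : Fin 2 | s ≠ t},
        sequenceElements (fun i k => Ultrapower.mk V (I s i k)) →
      ∀ y ∈ B, ∃ f : Ω → M, ((∃ m, f = fun _ => m) ∨ ∃ s, s ≠ t ∧ ∃ i, f = I s i 0) ∧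
        Ultrapower.mk V f = y := by
    rintro t B rfl y (⟨m, rfl⟩ | hy)
    · exact ⟨_, Or.inl ⟨m, rfl⟩, rfl⟩
    · simp only [Set.mem_iUnion] at hy
      obtain ⟨s, hs, i, k, rfl⟩ := hy
      rw [Subsingleton.elim k 0]
      exact ⟨_, Or.inr ⟨s, hs, i, rfl⟩, rfl⟩
  have hmut : L.MutuallyIndiscernible A fun t i k => Ultrapower.mk V (I t i k) := by
    intro t
    refine isIndiscernible_ultrapower V (I t) _ _ (hmem t _ rfl) ?_
    intro k i j hi hj g hg φ
    -- Parameters are constants or terms of the other sequence, so they do not involve the index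
    -- sequence being permuted. This gives mutual indiscernibility.
    have hg' : ∀ y, ∃ f : ℕ → (ℕ → ℕ) → M, ∀ σ τ n, g y (ULift.up (σ, τ, n)) =
        f n (if t = 0 then τ else σ) := by
      intro y
      rcases hg y with ⟨m, hm⟩ | ⟨s, hs, i, hi⟩
      · exact ⟨fun _ _ => m, fun σ τ n => by rw [hm]⟩
      · rw [hi]
        fin_cases t <;> fin_cases s
        · exact absurd rfl hs
        · exact ⟨fun n τ => b n (τ i), fun σ τ n => rfl⟩
        · exact ⟨fun n σ => a n (σ i), fun σ τ n => rfl⟩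
        · exact absurd rfl hs
    choose f hf using hg'
    rw [hV, hV]
    fin_cases t
    · simp only [hf]
      exact hW k i j hi hj fun s => ∀ᶠ τ in W, ∀ᶠ n in hyperfilter ℕ,
        φ.Realize (Sum.elim (fun y => f y n τ) fun c => a n (s c.1))
    · simp only [hf]
      refine eventually_congr (Eventually.of_forall fun σ => ?_)
      exact hW k i j hi hj fun s => ∀ᶠ n in hyperfilter ℕ,
        φ.Realize (Sum.elim (fun y => f y n σ) fun c => b n (s c.1))
  obtain ⟨t, ht⟩ := hdp (Ultrapower V M) A (fun _ => 1) _ hmut (Ultrapower.mk V ξ)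
  fin_cases t
  · exact not_isIndiscernible_insert V (I 0) ξ A (fun m => ⟨m, rfl⟩) hR
      (hξV.mono fun _ h => h.1) ht
  · exact not_isIndiscernible_insert V (I 1) ξ A (fun m => ⟨m, rfl⟩) hS
      (hξV.mono fun _ h => h.2) ht

end FirstOrder.Language

/-! ### Definable functions in a field -/

namespace FirstOrder.Ring

open FirstOrder.Language Set

section Definable

variable {K : Type*} [Field K] [CompatibleRing K] {α : Type*} {f g : (α → K) → K}

theorem definableFun_const (c : K) :
    (univ : Set K).DefinableFun Language.ring fun _ : α → K => c :=
  Language.definableFun_const (L := Language.ring) α (mem_univ c)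

theorem definableFun_add (hf : (univ : Set K).DefinableFun Language.ring f)
    (hg : (univ : Set K).DefinableFun Language.ring g) :
    (univ : Set K).DefinableFun Language.ring fun v => f v + g v := by
  have hF : (univ : Set K).DefinableMap Language.ring (fun v => ![f v, g v]) := by
    intro i
    fin_cases i
    · exact hf
    · exact hg
  simpa using DefinableFun.comp hF (DefinableFun.fun_symbol (M := K) addFunc).of_empty

theorem definableFun_mul (hf : (univ : Set K).DefinableFun Language.ring f)
    (hg : (univ : Set K).DefinableFun Language.ring g) :
    (univ : Set K).DefinableFun Language.ring fun v => f v * g v := by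
  have hF : (univ : Set K).DefinableMap Language.ring (fun v => ![f v, g v]) := by
    intro i
    fin_cases i
    · exact hf
    · exact hg
  simpa using DefinableFun.comp hF (DefinableFun.fun_symbol (M := K) mulFunc).of_empty

theorem definableFun_pow (hf : (univ : Set K).DefinableFun Language.ring f) (n : ℕ) :
    (univ : Set K).DefinableFun Language.ring fun v => f v ^ n := by
  induction n with
  | zero => simpa using definableFun_const (α := α) (1 : K)
  | succ n ih => simpa only [pow_succ] using definableFun_mul ih hf

theorem definableFun_inv (hf : (univ : Set K).DefinableFun Language.ring f) :
    (univ : Set K).DefinableFun Language.ring fun v => (f v)⁻¹ := by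
  have h : (univ : Set K).DefinableFun Language.ring fun v : Fin 1 → K => (v 0)⁻¹ := by
    have h1 : (univ : Set K).DefinableFun Language.ring fun w : Option (Fin 1) → K =>
        w (some 0) * w none := definableFun_mul (DefinableFun.proj _) (DefinableFun.proj _)
    have h2 : (univ : Set K).DefinableFun Language.ring fun w : Option (Fin 1) → K =>
        w (some 0) := DefinableFun.proj _
    have h3 : (univ : Set K).DefinableFun Language.ring fun w : Option (Fin 1) → K =>
        w none := DefinableFun.proj _
    -- The second piece of the graph accounts for the convention 0⁻¹ = 0.
    have := (h1.ofPred_eq (definableFun_const 1)).union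
      ((h2.ofPred_eq (definableFun_const 0)).inter (h3.ofPred_eq (definableFun_const 0)))
    refine (congrArg (Definable (univ : Set K) Language.ring) ?_).mp this
    ext w
    simp only [mem_union, mem_inter_iff, mem_ofPred_eq, Function.tupleGraph, Function.comp_apply]
    by_cases h0 : w (some 0) = 0
    · simp [h0, eq_comm]
    · simp only [h0, false_and, or_false]
      rw [mul_comm, mul_eq_one_iff_eq_inv₀ h0, eq_comm]
  have hF : (univ : Set K).DefinableMap Language.ring (fun v => ![f v]) := by
    intro i
    fin_cases i
    exact hf
  simpa using DefinableFun.comp hF h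

/-- The preimage of a definable subset of `K` under a definable function is definable in any
expansion of `K`. -/
theorem _root_.Set.Definable₁.preimage {L : Language.{u, v}} [L.Structure K]
    (F : LHom Language.ring L) [F.IsExpansionOn K] {X : Set K}
    (hX : (univ : Set K).Definable₁ L X) (hf : (univ : Set K).DefinableFun Language.ring f) :
    (univ : Set K).Definable L {v | f v ∈ X} := by
  have hF : (univ : Set K).DefinableMap L (fun v => ![f v]) := by
    intro i
    fin_cases i
    exact Definable.map_expansion hf F
  exact Definable.preimage_map hF hX

theorem definable_exists {S : Set (α ⊕ Fin 1 → K)}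
    (hS : (univ : Set K).Definable Language.ring S) :
    (univ : Set K).Definable Language.ring {v : α → K | ∃ z, Sum.elim v (fun _ => z) ∈ S} := by
  refine (congrArg _ ?_).mp hS.exists_of_finite
  ext v
  refine ⟨fun ⟨u, hu⟩ => ⟨u 0, ?_⟩, fun ⟨z, hz⟩ => ⟨_, hz⟩⟩
  rwa [show (fun _ => u 0) = u from funext fun i => by rw [Subsingleton.elim i 0] ]

end Definable

end FirstOrder.Ring

/-! ### Hensel's lemma and definability of the p-adic norm -/

namespace PadicInt

open Polynomial

variable {p : ℕ} [Fact p.Prime]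

theorem exists_pow_eq_of_norm_sub_one_lt {n : ℕ} {u : ℤ_[p]}
    (h : ‖u - 1‖ < ‖(n : ℤ_[p])‖ ^ 2) : ∃ z : ℤ_[p], z ^ n = u := by
  obtain ⟨z, hz, -⟩ := hensels_lemma (F := (X ^ n - C u : ℤ_[p][X])) (a := (1 : ℤ_[p]))
    (by simpa [norm_sub_rev, derivative_X_pow] using h)
  exact ⟨z, by simpa [sub_eq_zero] using hz⟩

end PadicInt

namespace Padic

variable {p : ℕ} [hp : Fact p.Prime]

theorem norm_two_sq_gt : ((p : ℝ) ^ 3)⁻¹ < ‖(2 : ℤ_[p])‖ ^ 2 := by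
  have h1 : (1 : ℝ) < p := by exact_mod_cast hp.out.one_lt
  by_cases h2 : p = 2
  · subst h2
    have : ‖(2 : ℤ_[2])‖ = (2 : ℝ)⁻¹ := by exact_mod_cast PadicInt.norm_p (p := 2)
    rw [this]
    norm_num
  · have : ‖(2 : ℤ_[p])‖ = 1 := by
      by_contra hne
      have hlt : ‖((2 : ℤ) : ℤ_[p])‖ < 1 := lt_of_le_of_ne (PadicInt.norm_le_one _) (by simpa using hne)
      rw [PadicInt.norm_int_lt_one_iff_dvd] at hlt
      exact h2 ((Nat.prime_dvd_prime_iff_eq hp.out Nat.prime_two).1 (by exact_mod_cast hlt))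
    rw [this]
    simpa using inv_lt_one_of_one_lt₀ (one_lt_pow₀ h1 (by norm_num : 3 ≠ 0))

/-- For integral t, Hensel's lemma gives the root; the cube of p is small enough even when p = 2.
Otherwise p³t⁴ has valuation 3 + 4v(t), which is negative and odd, so it dominates 1 and the sum is
not a square. The exponent 4 makes this valuation negative already at v(t) = -1. -/
theorem norm_le_one_iff_exists_sq (t : ℚ_[p]) :
    ‖t‖ ≤ 1 ↔ ∃ z : ℚ_[p], z ^ 2 = 1 + p ^ 3 * t ^ 4 := by
  constructor
  · intro ht
    let t' : ℤ_[p] := ⟨t, ht⟩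
    obtain ⟨z, hz⟩ := PadicInt.exists_pow_eq_of_norm_sub_one_lt (p := p) (n := 2)
      (u := 1 + p ^ 3 * t' ^ 4) (by
        refine lt_of_le_of_lt ?_ (by simpa using norm_two_sq_gt (p := p))
        simp only [add_sub_cancel_left, norm_mul, norm_pow, PadicInt.norm_p]
        rw [inv_pow]
        exact mul_le_of_le_one_right (by positivity)
          (pow_le_one₀ (norm_nonneg _) (PadicInt.norm_le_one _)))
    refine ⟨z, ?_⟩
    have := congrArg (fun y : ℤ_[p] => (y : ℚ_[p])) hz
    push_cast at this
    exact this
  · rintro ⟨z, hz⟩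
    by_contra! ht
    have hp1 : (1 : ℝ) < p := by exact_mod_cast hp.out.one_lt
    have hp0 : (p : ℚ_[p]) ≠ 0 := by exact_mod_cast hp.out.ne_zero
    have ht0 : t ≠ 0 := fun h => by simp [h] at ht; linarith
    have hw0 : (p : ℚ_[p]) ^ 3 * t ^ 4 ≠ 0 := by positivity
    have hval : ((p : ℚ_[p]) ^ 3 * t ^ 4).valuation = 3 + 4 * t.valuation := by
      rw [Padic.valuation_mul (by positivity) (by positivity), Padic.valuation_pow,
        Padic.valuation_pow, Padic.valuation_p]
      push_cast; ring
    have htv : t.valuation < 0 := by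
      rw [Padic.norm_eq_zpow_neg_valuation ht0, one_lt_zpow_iff_right₀ hp1] at ht
      omega
    have hw1 : 1 < ‖(p : ℚ_[p]) ^ 3 * t ^ 4‖ := by
      rw [Padic.norm_eq_zpow_neg_valuation hw0, hval, one_lt_zpow_iff_right₀ hp1]
      omega
    have hnorm : ‖z ^ 2‖ = ‖(p : ℚ_[p]) ^ 3 * t ^ 4‖ := by
      rw [hz, IsUltrametricDist.norm_add_eq_max_of_norm_ne_norm (by simpa using hw1.ne)]
      simpa using hw1.le
    have hz0 : z ≠ 0 := fun h => by
      rw [← hnorm, h] at hw1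
      norm_num at hw1
    rw [Padic.norm_eq_zpow_neg_valuation hw0, Padic.norm_eq_zpow_neg_valuation (pow_ne_zero 2 hz0),
      zpow_right_inj₀ (by positivity) hp1.ne', hval, Padic.valuation_pow] at hnorm
    push_cast at hnorm
    omega

theorem norm_le_norm_iff_exists (x y : ℚ_[p]) :
    ‖x‖ ≤ ‖y‖ ↔ ∃ z : ℚ_[p], z ^ 2 * y ^ 4 = y ^ 4 + p ^ 3 * x ^ 4 := by
  have hp0 : (p : ℚ_[p]) ≠ 0 := by exact_mod_cast hp.out.ne_zero
  rcases eq_or_ne y 0 with rfl | hy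
  · simp [hp0]
  · have h : ‖x‖ ≤ ‖y‖ ↔ ‖x / y‖ ≤ 1 := by
      rw [norm_div, div_le_one (norm_pos_iff.2 hy)]
    rw [h, norm_le_one_iff_exists_sq]
    refine exists_congr fun z => ?_
    rw [← mul_left_inj' (pow_ne_zero 4 hy)]
    have : (1 + (p : ℚ_[p]) ^ 3 * (x / y) ^ 4) * y ^ 4 = y ^ 4 + p ^ 3 * x ^ 4 := by
      field_simp
    rw [this]

end Padic

/-! ### Dp-minimality applied to scalings and balls -/

namespace FirstOrder.Ring

open FirstOrder.Language Set

variable {p : ℕ} [Fact p.Prime] [CompatibleRing (ℚ_[p])]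

theorem definable_norm_le_norm {α : Type*} {f g : (α → ℚ_[p]) → ℚ_[p]}
    (hf : (univ : Set ℚ_[p]).DefinableFun Language.ring f)
    (hg : (univ : Set ℚ_[p]).DefinableFun Language.ring g) :
    (univ : Set ℚ_[p]).Definable Language.ring {v | ‖f v‖ ≤ ‖g v‖} := by
  have h : (univ : Set ℚ_[p]).Definable Language.ring {v : Fin 2 → ℚ_[p] | ‖v 0‖ ≤ ‖v 1‖} := by
    have hproj : ∀ i, (univ : Set ℚ_[p]).DefinableFun Language.ring
        fun v : Fin 2 ⊕ Fin 1 → ℚ_[p] => v i := fun i => DefinableFun.proj _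
    have := definable_exists ((definableFun_mul (definableFun_pow (hproj (Sum.inr 0)) 2)
      (definableFun_pow (hproj (Sum.inl 1)) 4)).ofPred_eq
      (definableFun_add (definableFun_pow (hproj (Sum.inl 1)) 4)
        (definableFun_mul (definableFun_const ((p : ℚ_[p]) ^ 3))
          (definableFun_pow (hproj (Sum.inl 0)) 4))))
    simpa [Padic.norm_le_norm_iff_exists] using this
  have hF : (univ : Set ℚ_[p]).DefinableMap Language.ring (fun v => ![f v, g v]) := by
    intro i
    fin_cases i
    · exact hf
    · exact hg
  simpa using Definable.preimage_map hF h

/-- In a dp-minimal expansion of `ℚ_[p]`, the multiplicative translates of a definable set cannot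
cross many disjoint annuli around zero. -/
theorem exists_translates_agree_on_annulus {L : Language.{u, v}} [L.Structure (ℚ_[p])]
    (F : LHom Language.ring L) [F.IsExpansionOn (ℚ_[p])] (hdp : L.IsDpMinimal ℚ_[p])
    {X : Set ℚ_[p]} (hX : (univ : Set ℚ_[p]).Definable₁ L X) :
    ∃ n : ℕ, ∀ a b : ℕ → ℚ_[p], ∃ i i' j j', i < i' ∧ i' < n ∧ j < j' ∧ j' < n ∧
      ∀ x, ‖x‖ ≤ ‖b j‖ → ‖b j'‖ < ‖x‖ → (x * a i ∈ X ↔ x * a i' ∈ X) := by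
  by_contra! hcon
  have hproj : ∀ i, (univ : Set ℚ_[p]).DefinableFun Language.ring
        fun v : Fin 2 → ℚ_[p] => v i := fun i => DefinableFun.proj _
  refine not_isDpMinimal_of_crossing (hX.preimage F (definableFun_mul (hproj 0) (hproj 1)))
    ((definable_norm_le_norm (hproj 0) (hproj 1)).map_expansion F) (fun n => ?_) hdp
  obtain ⟨a, b, hab⟩ := hcon n
  refine ⟨a, b, fun i i' j j' h1 h2 h3 h4 => ?_⟩
  obtain ⟨x, hx1, hx2, hx⟩ := hab i i' j j' h1 h2 h3 h4
  refine ⟨x, ?_, ?_⟩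
  · simpa [iff_iff_and_or_not_and_not] using by tauto
  · simp [hx1, hx2]

end FirstOrder.Ring

/-! ### Coset covers and classes modulo n-th powers -/

open scoped Pointwise in
-- Greedy choice: the elements to avoid at stage k form k * n ≤ n * n cosets. By Neumann's lemma, if
-- these covered the group, one of the subgroups would have index at most n * n.
theorem Subgroup.exists_pairwise_inv_mul_notMem {G : Type*} [Group G] (S : ℕ → Subgroup G) (n : ℕ)
    (hS : ∀ j < n, ¬ ((S j).FiniteIndex ∧ (S j).index ≤ n * n)) :
    ∃ a : ℕ → G, ∀ i i' j, i < i' → i' < n → j < n → (a i)⁻¹ * a i' ∉ S j := by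
  suffices h : ∀ k ≤ n, ∃ a : ℕ → G, ∀ i i' j, i < i' → i' < k → j < n → (a i)⁻¹ * a i' ∉ S j from
    h n le_rfl
  intro k
  induction k with
  | zero => exact fun _ => ⟨1, fun i i' j _ h => absurd h (Nat.not_lt_zero _)⟩
  | succ k ih =>
    intro hk
    obtain ⟨a, ha⟩ := ih (by omega)
    obtain ⟨g, hg⟩ : ∃ g, ∀ i < k, ∀ j < n, (a i)⁻¹ * g ∉ S j := by
      by_contra! hcon
      have hcover : ⋃ t ∈ Finset.range k ×ˢ Finset.range n, a t.1 • (S t.2 : Set G) =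
          Set.univ := by
        refine Set.eq_univ_of_forall fun g => ?_
        obtain ⟨i, hi, j, hj, h⟩ := hcon g
        refine Set.mem_biUnion (x := (i, j)) (by simp [hi, hj]) ?_
        rwa [mem_leftCoset_iff]
      obtain ⟨t, ht, h1, h2⟩ := exists_index_le_card_of_leftCoset_cover hcover
      simp only [Finset.mem_product, Finset.mem_range] at ht
      refine hS t.2 ht.2 ⟨h1, h2.trans ?_⟩
      rw [Finset.card_product, Finset.card_range, Finset.card_range]
      exact Nat.mul_le_mul_right _ (by omega)
    refine ⟨Function.update a k g, fun i i' j h1 h2 h3 => ?_⟩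
    rw [Function.update_of_ne (show i ≠ k by omega)]
    rcases eq_or_ne i' k with rfl | h
    · rw [Function.update_self]
      exact hg i h1 j h3
    · rw [Function.update_of_ne h]
      exact ha i i' j h1 (by omega) h3

namespace Padic

variable {p : ℕ} [hp : Fact p.Prime]

theorem exists_unit_mul_zpow {x : ℚ_[p]} (hx : x ≠ 0) :
    ∃ (u : ℤ_[p]ˣ) (l : ℤ), x = (u : ℤ_[p]) * (p : ℚ_[p]) ^ l := by
  have hp0 : (p : ℚ_[p]) ≠ 0 := by exact_mod_cast hp.out.ne_zero
  have h1 : ‖x * (p : ℚ_[p]) ^ (-x.valuation)‖ = 1 := by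
    have : (p : ℝ) ≠ 0 := by exact_mod_cast hp.out.ne_zero
    rw [norm_mul, Padic.norm_eq_zpow_neg_valuation hx, Padic.norm_p_zpow, neg_neg,
      ← zpow_add₀ this, neg_add_cancel, zpow_zero]
  refine ⟨PadicInt.mkUnits h1, x.valuation, ?_⟩
  rw [PadicInt.mkUnits_eq, mul_assoc, ← zpow_add₀ hp0, neg_add_cancel, zpow_zero, mul_one]

/-- There are finitely many classes of nonzero `p`-adic numbers modulo `n`-th powers. -/
theorem exists_finset_forall_eq_mul_pow {n : ℕ} (hn : n ≠ 0) :
    ∃ C : Finset ℚ_[p], ∀ x : ℚ_[p], x ≠ 0 → ∃ c ∈ C, ∃ w, w ≠ 0 ∧ x = c * w ^ n := by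
  classical
  have hp0 : (p : ℚ_[p]) ≠ 0 := by exact_mod_cast hp.out.ne_zero
  have hp1 : (1 : ℝ) < p := by exact_mod_cast hp.out.one_lt
  have hn0 : 0 < ‖(n : ℤ_[p])‖ ^ 2 := by
    have : (n : ℤ_[p]) ≠ 0 := by exact_mod_cast hn
    positivity
  obtain ⟨K, hK⟩ := exists_pow_lt_of_lt_one hn0 (inv_lt_one_of_one_lt₀ hp1)
  -- Units congruent modulo p ^ (K + 1) differ by an n-th power. The extra 1 forces the residue `t`
  -- to be a unit even when K = 0.
  refine ⟨(Finset.range n ×ˢ Finset.range (p ^ (K + 1))).image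
    fun t => (p : ℚ_[p]) ^ t.1 * (t.2 : ℚ_[p]), fun x hx => ?_⟩
  obtain ⟨u, l, rfl⟩ := exists_unit_mul_zpow hx
  obtain ⟨t, htlt, ht⟩ : ∃ t : ℕ, t < p ^ (K + 1) ∧
      ‖(u : ℤ_[p]) - t‖ ≤ (p : ℝ) ^ (-(K + 1 : ℕ) : ℤ) :=
    ⟨(u : ℤ_[p]).appr (K + 1), PadicInt.appr_lt _ _,
      (PadicInt.norm_le_pow_iff_mem_span_pow _ _).2 (PadicInt.appr_spec (K + 1) (u : ℤ_[p]))⟩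
  rw [zpow_neg, zpow_natCast, ← inv_pow] at ht
  have hinv : (p : ℝ)⁻¹ ^ (K + 1) ≤ (p : ℝ)⁻¹ ^ K :=
    pow_le_pow_of_le_one (by positivity) (inv_lt_one_of_one_lt₀ hp1).le (Nat.le_succ K)
  have htu : ‖(t : ℤ_[p])‖ = 1 := by
    have hlt : ‖(u : ℤ_[p]) - t‖ < ‖(u : ℤ_[p])‖ := by
      rw [PadicInt.norm_units]
      exact ht.trans_lt (pow_lt_one₀ (by positivity) (inv_lt_one_of_one_lt₀ hp1) (by omega))
    have := PadicInt.norm_eq_of_norm_add_lt_left (sub_eq_add_neg (u : ℤ_[p]) t ▸ hlt)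
    rw [← norm_neg, ← this, PadicInt.norm_units]
  obtain ⟨t', ht'⟩ := PadicInt.isUnit_iff.2 htu
  obtain ⟨z, hz⟩ := PadicInt.exists_pow_eq_of_norm_sub_one_lt (n := n)
    (u := (u : ℤ_[p]) * ((t'⁻¹ : ℤ_[p]ˣ) : ℤ_[p])) (by
      have : (u : ℤ_[p]) * ((t'⁻¹ : ℤ_[p]ˣ) : ℤ_[p]) - 1 =
          (u - t) * ((t'⁻¹ : ℤ_[p]ˣ) : ℤ_[p]) := by
        rw [sub_mul, ← ht', Units.mul_inv]
      rw [this, norm_mul, PadicInt.norm_units, mul_one]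
      exact (ht.trans hinv).trans_lt hK)
  have hn' : (n : ℤ) ≠ 0 := by exact_mod_cast hn
  obtain ⟨a, ha⟩ := Int.eq_ofNat_of_zero_le (Int.emod_nonneg l hn')
  have han : a < n := by
    have := Int.emod_lt_of_pos l (by omega : (0 : ℤ) < n)
    omega
  have hl : l = a + (l / n) * n := by
    have := Int.emod_add_ediv_mul l n
    omega
  refine ⟨(p : ℚ_[p]) ^ a * (t : ℚ_[p]), Finset.mem_image.2 ⟨(a, t), ?_, rfl⟩,
    (z : ℚ_[p]) * (p : ℚ_[p]) ^ (l / n), ?_, ?_⟩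
  · simp only [Finset.mem_product, Finset.mem_range]
    exact ⟨han, htlt⟩
  · refine mul_ne_zero (fun h => ?_) (zpow_ne_zero _ hp0)
    have hz0 : z = 0 := Subtype.ext h
    rw [hz0, zero_pow hn] at hz
    exact (u * t'⁻¹).ne_zero (by rw [Units.val_mul, ← hz])
  · have h1 : (t : ℤ_[p]) * z ^ n = u := by
      rw [hz, ← ht', mul_comm, mul_assoc, Units.inv_mul, mul_one]
    have h2 : (t : ℚ_[p]) * (z : ℚ_[p]) ^ n = ((u : ℤ_[p]) : ℚ_[p]) := by
      rw [← h1]; push_cast; rfl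
    rw [mul_pow, ← zpow_natCast ((p : ℚ_[p]) ^ (l / n)), ← zpow_mul, ← h2]
    conv_lhs => rw [hl, zpow_add₀ hp0, zpow_natCast]
    ring

theorem norm_p_pow_le_norm_p_pow {i j : ℕ} (h : i ≤ j) :
    ‖(p : ℚ_[p]) ^ j‖ ≤ ‖(p : ℚ_[p]) ^ i‖ := by
  rw [norm_pow, norm_pow]
  exact pow_le_pow_of_le_one (norm_nonneg _) Padic.norm_p_lt_one.le h

theorem norm_p_pow_lt_norm_p_pow {i j : ℕ} (h : i < j) :
    ‖(p : ℚ_[p]) ^ j‖ < ‖(p : ℚ_[p]) ^ i‖ := by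
  rw [norm_pow, norm_pow]
  exact pow_lt_pow_right_of_lt_one₀ (norm_pos_iff.2 (by exact_mod_cast hp.out.ne_zero))
    Padic.norm_p_lt_one h

/-- The units of `ℤ_[p]` which stabilise the part of `X` in the sphere of radius `‖p ^ γ‖`. -/
def sphereStabilizer (X : Set ℚ_[p]) (γ : ℕ) : Subgroup ℤ_[p]ˣ where
  carrier := {u | ∀ x : ℚ_[p], ‖x‖ = ‖(p : ℚ_[p]) ^ γ‖ → ((u : ℤ_[p]) * x ∈ X ↔ x ∈ X)}
  one_mem' := fun x _ => by simp
  mul_mem' := fun {a b} ha hb x hx => by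
    rw [Units.val_mul, PadicInt.coe_mul, mul_assoc, ha _ (by simpa using hx), hb x hx]
  inv_mem' := fun {a} ha x hx => by
    rw [← ha _ (by simpa using hx), ← mul_assoc, ← PadicInt.coe_mul, Units.mul_inv]
    simp

end Padic

/-! ### Germs of definable sets, and gluing -/

namespace FirstOrder.Ring

open FirstOrder.Language Set Filter

variable {p : ℕ} [hp : Fact p.Prime] [CompatibleRing (ℚ_[p])] {L : Language.{u, v}}
  [L.Structure (ℚ_[p])] (F : LHom Language.ring L) [F.IsExpansionOn (ℚ_[p])]
  (hdp : L.IsDpMinimal ℚ_[p]) {X : Set ℚ_[p]} (hX : (univ : Set ℚ_[p]).Definable₁ L X)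

include F hdp hX

theorem exists_units_pow_mul_mem_iff :
    ∃ m δ : ℕ, m ≠ 0 ∧ ∀ (u : ℤ_[p]ˣ) (x : ℚ_[p]), ‖x‖ ≤ ‖(p : ℚ_[p]) ^ δ‖ →
      (((u : ℤ_[p]) : ℚ_[p]) ^ m * x ∈ X ↔ x ∈ X) := by
  obtain ⟨n, hn⟩ := exists_translates_agree_on_annulus F hdp hX
  let Γ : Set ℕ := {γ | ¬ ((Padic.sphereStabilizer X γ).FiniteIndex ∧
    (Padic.sphereStabilizer X γ).index ≤ n * n)}
  have hΓ : Γ.Finite := by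
    by_contra hinf
    have hinf : Γ.Infinite := hinf
    let e : ℕ → ℕ := Nat.nth (· ∈ Γ)
    have he : StrictMono e := Nat.nth_strictMono hinf
    have heΓ : ∀ j, e j ∈ Γ := fun j => Nat.nth_mem_of_infinite hinf j
    obtain ⟨a, ha⟩ := Subgroup.exists_pairwise_inv_mul_notMem
      (fun j => Padic.sphereStabilizer X (e j)) n fun j _ => heΓ j
    obtain ⟨i, i', j, j', h1, h2, h3, h4, h⟩ :=
      hn (fun i => ((a i : ℤ_[p]) : ℚ_[p])) (fun j => (p : ℚ_[p]) ^ e j)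
    refine ha i i' j h1 h2 (h3.trans h4) fun z hz => ?_
    have hx : ‖(((a i)⁻¹ : ℤ_[p]ˣ) : ℤ_[p]) * z‖ = ‖(p : ℚ_[p]) ^ e j‖ := by simpa using hz
    have := h _ hx.le (hx ▸ Padic.norm_p_pow_lt_norm_p_pow (he h3))
    have hone : ((((a i)⁻¹ : ℤ_[p]ˣ) : ℤ_[p]) : ℚ_[p]) * ((a i : ℤ_[p]) : ℚ_[p]) = 1 := by
      rw [← PadicInt.coe_mul, Units.inv_mul, PadicInt.coe_one]
    rw [mul_right_comm, hone, one_mul, mul_right_comm] at this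
    rw [Units.val_mul, PadicInt.coe_mul, this]
  obtain ⟨δ, hδ⟩ := hΓ.bddAbove
  -- The factorial is a multiple of every index up to n * n.
  refine ⟨(n * n).factorial, δ + 1, Nat.factorial_ne_zero _, fun u x hx => ?_⟩
  rcases eq_or_ne x 0 with rfl | hx0
  · simp
  obtain ⟨u', l, rfl⟩ := Padic.exists_unit_mul_zpow hx0
  have hl : ((δ + 1 : ℕ) : ℤ) ≤ l := by
    have hp1 : (1 : ℝ) < p := by exact_mod_cast hp.out.one_lt
    rw [norm_mul, PadicInt.padic_norm_e_of_padicInt, PadicInt.norm_units, one_mul,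
      Padic.norm_p_zpow, Padic.norm_p_pow, zpow_le_zpow_iff_right₀ hp1] at hx
    omega
  obtain ⟨γ, rfl⟩ := Int.eq_ofNat_of_zero_le ((Int.natCast_nonneg _).trans hl)
  have hγ : γ ∉ Γ := fun h => by
    have := hδ h
    omega
  obtain ⟨h1, h2⟩ := not_not.1 hγ
  have hmem : u ^ (n * n).factorial ∈ Padic.sphereStabilizer X γ := by
    obtain ⟨d, hd⟩ := Nat.dvd_factorial (Nat.pos_of_ne_zero h1.index_ne_zero) h2
    rw [hd, pow_mul]
    exact Subgroup.pow_mem _ (Subgroup.pow_index_mem _ u) d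
  have := hmem (((u' : ℤ_[p]) : ℚ_[p]) * (p : ℚ_[p]) ^ (γ : ℤ)) (by simp)
  simpa using this

theorem exists_p_pow_mul_mem_iff :
    ∃ k δ : ℕ, k ≠ 0 ∧ ∀ x : ℚ_[p], ‖x‖ ≤ ‖(p : ℚ_[p]) ^ δ‖ → ((p : ℚ_[p]) ^ k * x ∈ X ↔ x ∈ X) := by
  obtain ⟨n, hn⟩ := exists_translates_agree_on_annulus F hdp hX
  have hp0 : (p : ℚ_[p]) ≠ 0 := by exact_mod_cast hp.out.ne_zero
  by_contra! hcon
  have hz : ∀ γ k : ℕ, ∃ z : ℚ_[p], z ≠ 0 ∧ (k ≠ 0 → ‖z‖ ≤ ‖(p : ℚ_[p]) ^ γ‖ ∧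
      ¬ ((p : ℚ_[p]) ^ k * z ∈ X ↔ z ∈ X)) := by
    intro γ k
    rcases eq_or_ne k 0 with rfl | hk
    · exact ⟨1, one_ne_zero, fun h => absurd rfl h⟩
    · obtain ⟨z, hz1, hz2⟩ := hcon k γ hk
      have hbad : ¬ ((p : ℚ_[p]) ^ k * z ∈ X ↔ z ∈ X) := by tauto
      refine ⟨z, ?_, fun _ => ⟨hz1, hbad⟩⟩
      rintro rfl
      simp at hbad
  choose z hz0 hz using hz
  -- The shift by n leaves room to divide a counterexample by p ^ i with i < n and stay in the ball
  -- of radius ‖p ^ γ‖. Iterating gives annuli that each contain a counterexample for every exponent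
  -- 0 < k < n.
  have hstep : ∀ γ : ℕ, ∃ γ' : ℕ, γ ≤ γ' ∧ ∀ k < n, ‖(p : ℚ_[p]) ^ γ'‖ < ‖z (γ + n) k‖ := by
    intro γ
    have htend : Tendsto (fun i : ℕ => ‖(p : ℚ_[p]) ^ i‖) atTop (nhds 0) := by
      simp only [norm_pow]
      exact tendsto_pow_atTop_nhds_zero_of_lt_one (norm_nonneg _) Padic.norm_p_lt_one
    have hall : ∀ᶠ i : ℕ in atTop, ∀ k ∈ Finset.range n, ‖(p : ℚ_[p]) ^ i‖ < ‖z (γ + n) k‖ :=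
      (Finset.eventually_all _).2 fun k _ =>
        htend.eventually (gt_mem_nhds (norm_pos_iff.2 (hz0 _ _)))
    obtain ⟨γ', h1, h2⟩ := ((eventually_ge_atTop γ).and hall).exists
    exact ⟨γ', h1, fun k hk => h2 k (Finset.mem_range.2 hk)⟩
  choose G hG1 hG2 using hstep
  let e : ℕ → ℕ := fun j => G^[j] 0
  have he1 : ∀ j, e (j + 1) = G (e j) := fun j => Function.iterate_succ_apply' _ _ _
  have he : Monotone e := monotone_nat_of_le_succ fun j => (he1 j).symm ▸ hG1 _
  obtain ⟨i, i', j, j', h1, h2, h3, h4, h⟩ :=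
    hn (fun i => (p : ℚ_[p]) ^ i) (fun j => (p : ℚ_[p]) ^ e j)
  obtain ⟨hzn, hbad⟩ := hz (e j + n) (i' - i) (by omega)
  set y := z (e j + n) (i' - i) with hy
  have hxi : y * ((p : ℚ_[p]) ^ i)⁻¹ * (p : ℚ_[p]) ^ i = y := by
    rw [mul_assoc, inv_mul_cancel₀ (pow_ne_zero _ hp0), mul_one]
  have hnorm : ‖y * ((p : ℚ_[p]) ^ i)⁻¹‖ * ‖(p : ℚ_[p]) ^ i‖ = ‖y‖ := by rw [← norm_mul, hxi]
  have hipos : 0 < ‖(p : ℚ_[p]) ^ i‖ := norm_pos_iff.2 (pow_ne_zero _ hp0)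
  have hi1 : ‖(p : ℚ_[p]) ^ i‖ ≤ 1 := by
    simpa using Padic.norm_p_pow_le_norm_p_pow (p := p) (Nat.zero_le i)
  have key := h (y * ((p : ℚ_[p]) ^ i)⁻¹) ?_ ?_
  · rw [hxi] at key
    refine hbad ?_
    rw [key, show i' = (i' - i) + i by omega, pow_add, mul_comm ((p : ℚ_[p]) ^ (i' - i)) (p ^ i),
      ← mul_assoc, hxi, mul_comm, show i' - i + i - i = i' - i by omega]
  · refine le_of_mul_le_mul_right ?_ hipos
    rw [hnorm, ← norm_mul, ← pow_add]
    exact hzn.trans (Padic.norm_p_pow_le_norm_p_pow (by omega))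
  · have h5 : ‖(p : ℚ_[p]) ^ e j'‖ < ‖y‖ :=
      (Padic.norm_p_pow_le_norm_p_pow (he (show j + 1 ≤ j' from h3))).trans_lt
        (he1 j ▸ hG2 _ _ (by omega))
    rw [← hnorm] at h5
    exact h5.trans_le (mul_le_of_le_one_right (norm_nonneg _) hi1)

theorem exists_pow_mul_mem_iff :
    ∃ n δ : ℕ, n ≠ 0 ∧ ∀ w x : ℚ_[p], w ≠ 0 → ‖x‖ ≤ ‖(p : ℚ_[p]) ^ δ‖ →
      ‖w ^ n * x‖ ≤ ‖(p : ℚ_[p]) ^ δ‖ → (w ^ n * x ∈ X ↔ x ∈ X) := by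
  obtain ⟨m, δ, hm, hu⟩ := exists_units_pow_mul_mem_iff F hdp hX
  obtain ⟨k, ε, hk, hpk⟩ := exists_p_pow_mul_mem_iff F hdp hX
  have hp1 : ‖(p : ℚ_[p])‖ ≤ 1 := Padic.norm_p_lt_one.le
  have hp0 : (p : ℚ_[p]) ≠ 0 := by exact_mod_cast hp.out.ne_zero
  have hpkl : ∀ (l : ℕ) (x : ℚ_[p]), ‖x‖ ≤ ‖(p : ℚ_[p]) ^ ε‖ →
      ((p : ℚ_[p]) ^ (k * l) * x ∈ X ↔ x ∈ X) := by
    intro l x hx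
    induction l with
    | zero => simp
    | succ l ih =>
      rw [← ih, Nat.mul_succ, add_comm, pow_add, mul_assoc, hpk]
      rw [norm_mul, norm_pow]
      exact (mul_le_of_le_one_left (norm_nonneg _) (pow_le_one₀ (norm_nonneg _) hp1)).trans hx
  have hnat : ∀ (l : ℕ) (u : ℤ_[p]ˣ) (x : ℚ_[p]), ‖x‖ ≤ ‖(p : ℚ_[p]) ^ (max δ ε)‖ →
      ((((u : ℤ_[p]) : ℚ_[p]) * (p : ℚ_[p]) ^ l) ^ (k * m) * x ∈ X ↔ x ∈ X) := by
    intro l u x hx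
    have hδ := hx.trans (Padic.norm_p_pow_le_norm_p_pow (le_max_left δ ε))
    have hε := hx.trans (Padic.norm_p_pow_le_norm_p_pow (le_max_right δ ε))
    have h1 : (((u : ℤ_[p]) : ℚ_[p]) * (p : ℚ_[p]) ^ l) ^ (k * m) * x =
        (((u ^ k : ℤ_[p]ˣ) : ℤ_[p]) : ℚ_[p]) ^ m * ((p : ℚ_[p]) ^ (k * (l * m)) * x) := by
      push_cast
      ring
    rw [h1, hu, hpkl _ _ hε]
    rw [norm_mul, norm_pow]
    exact (mul_le_of_le_one_left (norm_nonneg _) (pow_le_one₀ (norm_nonneg _) hp1)).trans hδ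
  refine ⟨k * m, max δ ε, mul_ne_zero hk hm, fun w x hw hx hwx => ?_⟩
  obtain ⟨u, l, rfl⟩ := Padic.exists_unit_mul_zpow hw
  rcases Int.eq_nat_or_neg l with ⟨l, rfl | rfl⟩
  · rw [zpow_natCast]
    exact hnat l u x hx
  -- For negative valuation, the inverse of w is applied to w ^ n * x; this is why both points are
  -- required to lie in the ball.
  · have := hnat l u⁻¹ _ hwx
    rw [← this, ← mul_assoc, ← mul_pow]
    have h1 : ((((u⁻¹ : ℤ_[p]ˣ) : ℤ_[p]) : ℚ_[p]) * (p : ℚ_[p]) ^ l) *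
        (((u : ℤ_[p]) : ℚ_[p]) * (p : ℚ_[p]) ^ (-(l : ℤ))) = 1 := by
      rw [mul_mul_mul_comm, ← PadicInt.coe_mul, Units.inv_mul, PadicInt.coe_one, one_mul, zpow_neg,
        zpow_natCast, mul_inv_cancel₀ (pow_ne_zero _ hp0)]
    rw [h1, one_pow, one_mul]

/-- The germ at zero of a definable set is definable in the field `ℚ_[p]`. -/
theorem exists_definable_inter_closedBall_zero :
    ∃ δ : ℕ, (univ : Set ℚ_[p]).Definable₁ Language.ring {x | x ∈ X ∧ ‖x‖ ≤ ‖(p : ℚ_[p]) ^ δ‖} := by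
  classical
  obtain ⟨n, δ, hn, h⟩ := exists_pow_mul_mem_iff F hdp hX
  obtain ⟨C, hC⟩ := Padic.exists_finset_forall_eq_mul_pow (p := p) hn
  -- The classes that meet X inside the ball. By invariance, X contains all of their points there; 0
  -- is treated separately.
  let C' := C.filter fun c => ∃ w, w ≠ 0 ∧ c * w ^ n ∈ X ∧ ‖c * w ^ n‖ ≤ ‖(p : ℚ_[p]) ^ δ‖
  have hproj : ∀ i, (univ : Set ℚ_[p]).DefinableFun Language.ring
        fun v : Fin 1 ⊕ Fin 1 → ℚ_[p] => v i := fun i => DefinableFun.proj _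
  have hproj' : (univ : Set ℚ_[p]).DefinableFun Language.ring
        fun v : Fin 1 → ℚ_[p] => v 0 := DefinableFun.proj _
  have hpow : ∀ c : ℚ_[p], (univ : Set ℚ_[p]).Definable Language.ring
      {v : Fin 1 → ℚ_[p] | ∃ w, v 0 = c * w ^ n} := fun c => by
    simpa using definable_exists ((hproj (Sum.inl 0)).ofPred_eq
      (definableFun_mul (definableFun_const c) (definableFun_pow (hproj (Sum.inr 0)) n)))
  have hzero := hproj'.ofPred_eq (definableFun_const (0 : ℚ_[p]))
  have hball := definable_norm_le_norm hproj' (definableFun_const ((p : ℚ_[p]) ^ δ))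
  have hmain := ((definable_biUnion_finset (fun c => hpow c) C').inter hball).inter hzero.compl
  have heq : ∀ x : ℚ_[p], x ≠ 0 → ‖x‖ ≤ ‖(p : ℚ_[p]) ^ δ‖ →
      (x ∈ X ↔ ∃ c ∈ C', ∃ w, x = c * w ^ n) := by
    intro x hx0 hx
    constructor
    · intro hxX
      obtain ⟨c, hc, w, hw, rfl⟩ := hC x hx0
      exact ⟨c, Finset.mem_filter.2 ⟨hc, w, hw, hxX, hx⟩, w, rfl⟩
    · rintro ⟨c, hc, w, rfl⟩
      obtain ⟨-, w', hw', hX', hle⟩ := Finset.mem_filter.1 hc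
      have hw : w ≠ 0 := by
        rintro rfl
        simp [hn] at hx0
      have hcw : (w / w') ^ n * (c * w' ^ n) = c * w ^ n := by
        rw [div_pow]
        field_simp
      have := h (w / w') (c * w' ^ n) (div_ne_zero hw hw') hle (by rwa [hcw])
      rw [hcw] at this
      exact this.2 hX'
  refine ⟨δ, ?_⟩
  by_cases h0 : (0 : ℚ_[p]) ∈ X
  · refine (congrArg (Definable (univ : Set ℚ_[p]) Language.ring) ?_).mp (hmain.union hzero)
    ext v
    simp only [mem_union, mem_inter_iff, mem_iUnion, mem_compl_iff, mem_ofPred_eq, exists_prop]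
    by_cases hv : v 0 = 0
    · simp [hv, h0]
    · simp only [hv, not_false_eq_true, and_true, or_false]
      exact and_congr_left fun hr => (heq (v 0) hv hr).symm
  · refine (congrArg (Definable (univ : Set ℚ_[p]) Language.ring) ?_).mp hmain
    ext v
    simp only [mem_inter_iff, mem_iUnion, mem_compl_iff, mem_ofPred_eq, exists_prop]
    by_cases hv : v 0 = 0
    · simp [hv, h0]
    · simp only [hv, not_false_eq_true, and_true]
      exact and_congr_left fun hr => (heq (v 0) hv hr).symm

theorem exists_definable_inter_closedBall (a : ℚ_[p]) :
    ∃ δ : ℕ, (univ : Set ℚ_[p]).Definable₁ Language.ring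
      {x | x ∈ X ∧ ‖x - a‖ ≤ ‖(p : ℚ_[p]) ^ δ‖} := by
  have hproj : (univ : Set ℚ_[p]).DefinableFun Language.ring
        fun v : Fin 1 → ℚ_[p] => v 0 := DefinableFun.proj _
  have hXa : (univ : Set ℚ_[p]).Definable₁ L {x | x + a ∈ X} :=
    hX.preimage F (definableFun_add hproj (definableFun_const a))
  obtain ⟨δ, hδ⟩ := exists_definable_inter_closedBall_zero F hdp hXa
  refine ⟨δ, ?_⟩
  have := hδ.preimage (LHom.id _) (definableFun_add hproj (definableFun_const (-a)))
  simpa [Definable₁, ← sub_eq_add_neg] using this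

/-- The germ at infinity, by inversion. The norm condition also holds at x = 0, which is harmless
because the set stays inside X. -/
theorem exists_definable_inter_compl_closedBall :
    ∃ δ : ℕ, (univ : Set ℚ_[p]).Definable₁ Language.ring
      {x | x ∈ X ∧ ‖x⁻¹‖ ≤ ‖(p : ℚ_[p]) ^ δ‖} := by
  have hproj : (univ : Set ℚ_[p]).DefinableFun Language.ring
        fun v : Fin 1 → ℚ_[p] => v 0 := DefinableFun.proj _
  have hXi : (univ : Set ℚ_[p]).Definable₁ L {x | x⁻¹ ∈ X} :=
    hX.preimage F (definableFun_inv hproj)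
  obtain ⟨δ, hδ⟩ := exists_definable_inter_closedBall_zero F hdp hXi
  refine ⟨δ, ?_⟩
  have := hδ.preimage (LHom.id _) (definableFun_inv hproj)
  simpa only [Definable₁, mem_ofPred_eq, inv_inv] using this

theorem definable₁_of_isDpMinimal : (univ : Set ℚ_[p]).Definable₁ Language.ring X := by
  have hp0 : (p : ℚ_[p]) ≠ 0 := by exact_mod_cast hp.out.ne_zero
  obtain ⟨δ, hδ⟩ := exists_definable_inter_compl_closedBall F hdp hX
  obtain ⟨D, hD, hDX, hKD⟩ : ∃ D, (univ : Set ℚ_[p]).Definable₁ Language.ring D ∧ D ⊆ X ∧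
      -- Asking only for X ∩ s ⊆ D ⊆ X, instead of equality, makes the property pass to subsets of
      -- s, as compact induction requires.
      X ∩ Metric.closedBall 0 ‖(p : ℚ_[p]) ^ δ‖⁻¹ ⊆ D := by
    refine (isCompact_closedBall (0 : ℚ_[p]) ‖(p : ℚ_[p]) ^ δ‖⁻¹).induction_on
      (p := fun s => ∃ D, (univ : Set ℚ_[p]).Definable₁ Language.ring D ∧ D ⊆ X ∧ X ∩ s ⊆ D)
      ⟨∅, definable_empty, empty_subset _, by simp⟩ ?_ ?_ ?_
    · rintro s t hst ⟨D, h1, h2, h3⟩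
      exact ⟨D, h1, h2, (inter_subset_inter_right _ hst).trans h3⟩
    · rintro s t ⟨D, h1, h2, h3⟩ ⟨E, h4, h5, h6⟩
      refine ⟨D ∪ E, h1.union h4, union_subset h2 h5, ?_⟩
      rw [inter_union_distrib_left]
      exact union_subset_union h3 h6
    · intro a _
      obtain ⟨ε, hε⟩ := exists_definable_inter_closedBall F hdp hX a
      refine ⟨Metric.closedBall a ‖(p : ℚ_[p]) ^ ε‖, mem_nhdsWithin_of_mem_nhds
        (Metric.closedBall_mem_nhds a (norm_pos_iff.2 (pow_ne_zero _ hp0))), _, hε,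
        fun x hx => hx.1, fun x hx => ⟨hx.1, by simpa [dist_eq_norm] using hx.2⟩⟩
  refine (congrArg (Definable (univ : Set ℚ_[p]) Language.ring) ?_).mp (hD.union hδ)
  ext v
  simp only [mem_union, mem_ofPred_eq]
  refine ⟨fun h => h.elim (fun h => hDX h) And.left, fun h => ?_⟩
  by_cases hv : ‖v 0‖ ≤ ‖(p : ℚ_[p]) ^ δ‖⁻¹
  · exact Or.inl (hKD ⟨h, by simpa using hv⟩)
  · refine Or.inr ⟨h, ?_⟩
    rw [norm_inv]
    exact inv_le_of_inv_le₀ (norm_pos_iff.2 (pow_ne_zero _ hp0)) (not_le.1 hv).le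

end FirstOrder.Ring

theorem mainTheorem4 (p : ℕ) [Fact p.Prime] [FirstOrder.Ring.CompatibleRing ℚ_[p]]
    (L : FirstOrder.Language.{u, v}) [L.Structure ℚ_[p]]
    (f : FirstOrder.Language.LHom FirstOrder.Language.ring L) [f.IsExpansionOn ℚ_[p]]
    (hdp : L.IsDpMinimal ℚ_[p]) :
    FirstOrder.Language.IsMinimalOver FirstOrder.Language.ring L ℚ_[p] :=
  fun _ hX => FirstOrder.Ring.definable₁_of_isDpMinimal f hdp hX
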